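/- Let $N\ge 0$ and $d_1,\dots,d_N\ge 1$, and let $\mathbf H=\mathbb C^{d_1}\otimes\cdots\otimes\mathbb C^{d_N}$ (after a choice of orthonormal bases, every tensor product of finitely many nonzero finite-dimensional complex Hilbert spaces is of this form). Let $\mathcal E$ be the real vector space of self-adjoint operators on $\mathbf H$ with the inner product $\langle A,B\rangle=\operatorname{tr}(AB)$. Let $\mathbf P\subset\mathcal E$ be the set of pure product states, that is, of the operators $P^{(1)}\otimes\cdots\otimes P^{(N)}$ where each $P^{(k)}$ is a one-dimensional orthogonal projector in $\mathbb C^{d_k}$, and let $\sigma$ be the probability measure on $\mathbf P$ that is invariant under all local unitary transformations $P\mapsto UPU^*$, $U=U_1\otimes\cdots\otimes U_N$, $U_k\in U(d_k)$ (the image of the normalized Haar measure of $U(d_1)\times\cdots\times U(d_N)$ under the orbit map). The set of separable density operators is the convex hull of $\mathbf P$; let $\mathcal D$ be its interior relative to the affine space of the self-adjoint operators with trace one. Let $\mathcal N\subset\mathcal E$ be the subspace of traceless self-adjoint operators. For $X\in\mathcal E$ put $$W(X)=\ln\int_{\mathbf P}e^{\operatorname{tr}(XP)}\,d\sigma(P).$$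 **Theorem.** The function $W$ is $C^\infty$ on $\mathcal E$, and its gradient map $\chi=\nabla W:\mathcal E\to\mathcal E$ (with respect to the inner product above) restricts to a $C^\infty$ diffeomorphism of $\mathcal N$ onto $\mathcal D$: $\chi$ maps $\mathcal N$ bijectively onto $\mathcal D$, and both $\chi|_{\mathcal N}$ and its inverse $\mathcal D\to\mathcal N$ are smooth. -/

import Mathlib

open MeasureTheory Matrix
open scoped ContDiff Gradient

section Operators

variable {N : ℕ}

/-- The index set of the product basis of `ℂ^{d 0} ⊗ ⋯ ⊗ ℂ^{d (N-1)}`. -/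
abbrev ProdIdx (d : Fin N → ℕ) : Type := ∀ k, Fin (d k)

/-- Operators on `ℂ^{d 0} ⊗ ⋯ ⊗ ℂ^{d (N-1)}`, as matrices in the product basis. -/
abbrev ProdOp (d : Fin N → ℕ) : Type := Matrix (ProdIdx d) (ProdIdx d) ℂ

/-- The self-adjoint operators on `ℂ^{d 0} ⊗ ⋯ ⊗ ℂ^{d (N-1)}`. -/
def HermOp (d : Fin N → ℕ) : Type := selfAdjoint (ProdOp d)

variable {d : Fin N → ℕ}

/-- The underlying operator of a self-adjoint operator. -/
def HermOp.toOp (A : HermOp d) : ProdOp d := Subtype.val A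

theorem HermOp.conjTranspose_toOp (A : HermOp d) : A.toOpᴴ = A.toOp := A.2

theorem HermOp.ext_toOp {A B : HermOp d} (h : A.toOp = B.toOp) : A = B := Subtype.ext h

noncomputable instance : AddCommGroup (HermOp d) :=
  inferInstanceAs (AddCommGroup (selfAdjoint (ProdOp d)))

noncomputable instance : Module ℝ (HermOp d) :=
  inferInstanceAs (Module ℝ (selfAdjoint (ProdOp d)))

instance : FiniteDimensional ℝ (HermOp d) :=
  inferInstanceAs (FiniteDimensional ℝ (selfAdjoint.submodule ℝ (ProdOp d)))

@[simp] theorem HermOp.toOp_add (A B : HermOp d) : (A + B).toOp = A.toOp + B.toOp := rfl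

@[simp] theorem HermOp.toOp_smul (r : ℝ) (A : HermOp d) : (r • A).toOp = r • A.toOp := rfl

/-- The real number `tr (A B)`, for self-adjoint operators `A` and `B`. -/
noncomputable def trMul (A B : HermOp d) : ℝ := (A.toOp * B.toOp).trace.re

theorem ofReal_trMul (A B : HermOp d) : (trMul A B : ℂ) = (A.toOp * B.toOp).trace := by
  refine Complex.conj_eq_iff_re.mp ?_
  rw [starRingEnd_apply, ← Matrix.trace_conjTranspose, Matrix.conjTranspose_mul,
    A.conjTranspose_toOp, B.conjTranspose_toOp, Matrix.trace_mul_comm]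

theorem trMul_self (A : HermOp d) : trMul A A = ∑ i, ∑ j, ‖A.toOp i j‖ ^ 2 := by
  rw [trMul, Matrix.trace, Complex.re_sum]
  refine Finset.sum_congr rfl fun i _ => ?_
  rw [Matrix.diag_apply, Matrix.mul_apply, Complex.re_sum]
  refine Finset.sum_congr rfl fun j _ => ?_
  have h : A.toOp j i = star (A.toOp i j) := by
    conv_lhs => rw [← A.conjTranspose_toOp]
    rfl
  rw [h, ← starRingEnd_apply, Complex.mul_conj, Complex.normSq_eq_norm_sq]
  norm_cast

/-- The Hilbert-Schmidt inner product `⟪A, B⟫ = tr (A B)` on self-adjoint operators. -/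
@[reducible] noncomputable def hsCore : InnerProductSpace.Core ℝ (HermOp d) where
  inner A B := trMul A B
  conj_inner_symm A B := by
    simp only [trMul, conj_trivial]
    rw [Matrix.trace_mul_comm]
  re_inner_nonneg A := by
    simp only [trMul_self, RCLike.re_to_real]
    positivity
  add_left A B C := by
    simp [trMul, add_mul]
  smul_left A B r := by
    simp [trMul]
  definite A h := by
    rw [trMul_self, Finset.sum_eq_zero_iff_of_nonneg (fun i _ => by positivity)] at h
    refine HermOp.ext_toOp (Matrix.ext fun i j => ?_)
    have h1 := h i (Finset.mem_univ i)
    rw [Finset.sum_eq_zero_iff_of_nonneg (fun j _ => by positivity)] at h1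
    have h2 := h1 j (Finset.mem_univ j)
    exact norm_eq_zero.mp (pow_eq_zero_iff two_ne_zero |>.mp h2)

noncomputable instance : NormedAddCommGroup (HermOp d) :=
  hsCore.toNormedAddCommGroup

noncomputable instance : InnerProductSpace ℝ (HermOp d) :=
  InnerProductSpace.ofCore hsCore.toCore

theorem inner_eq_trMul (A B : HermOp d) : inner ℝ A B = trMul A B := rfl

instance : CompleteSpace (HermOp d) := FiniteDimensional.complete ℝ (HermOp d)

/-- The inclusion of the self-adjoint operators into all operators, as a linear map. -/
def HermOp.toOpLin : HermOp d →ₗ[ℝ] ProdOp d where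
  toFun := HermOp.toOp
  map_add' _ _ := rfl
  map_smul' _ _ := rfl

theorem HermOp.isClosedEmbedding_toOp :
    Topology.IsClosedEmbedding (HermOp.toOp : HermOp d → ProdOp d) :=
  LinearMap.isClosedEmbedding_of_injective (f := HermOp.toOpLin)
    (LinearMap.ker_eq_bot.mpr fun _ _ h => HermOp.ext_toOp h)

theorem HermOp.continuous_toOp : Continuous (HermOp.toOp : HermOp d → ProdOp d) :=
  HermOp.isClosedEmbedding_toOp.continuous

theorem continuous_hermOp_iff {α : Type*} [TopologicalSpace α] {f : α → HermOp d} :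
    Continuous f ↔ Continuous fun x => (f x).toOp :=
  HermOp.isClosedEmbedding_toOp.isInducing.continuous_iff

end Operators

section ProductStates

variable {N : ℕ} {d : Fin N → ℕ}

/-- The projector `|ψ⟩⟨ψ|` (one-dimensional when `ψ` is a unit vector). -/
noncomputable def ketBra {n : ℕ} (ψ : EuclideanSpace ℂ (Fin n)) : Matrix (Fin n) (Fin n) ℂ :=
  Matrix.of fun i j => ψ i * star (ψ j)

/-- The tensor product `A 0 ⊗ ⋯ ⊗ A (N-1)` of operators on the factors. -/
noncomputable def tensorOp (A : ∀ k, Matrix (Fin (d k)) (Fin (d k)) ℂ) : ProdOp d :=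
  Matrix.of fun i j => ∏ k, A k (i k) (j k)

theorem tensorOp_mul (A B : ∀ k, Matrix (Fin (d k)) (Fin (d k)) ℂ) :
    tensorOp A * tensorOp B = tensorOp fun k => A k * B k := by
  ext i j
  simp only [tensorOp, Matrix.mul_apply, Matrix.of_apply, ← Finset.prod_mul_distrib]
  exact (Fintype.prod_sum fun k l => A k (i k) l * B k l (j k)).symm

theorem conjTranspose_tensorOp (A : ∀ k, Matrix (Fin (d k)) (Fin (d k)) ℂ) :
    (tensorOp A)ᴴ = tensorOp fun k => (A k)ᴴ := by
  ext i j
  simp [tensorOp, Matrix.conjTranspose_apply]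

theorem ketBra_eq_vecMulVec {n : ℕ} (ψ : EuclideanSpace ℂ (Fin n)) :
    ketBra ψ = Matrix.vecMulVec ψ.ofLp (star ψ.ofLp) := rfl

theorem isSelfAdjoint_tensorOp_ketBra (ψ : ∀ k, EuclideanSpace ℂ (Fin (d k))) :
    IsSelfAdjoint (tensorOp fun k => ketBra (ψ k)) := by
  ext i j
  simp [tensorOp, ketBra, Matrix.star_apply, mul_comm]

/-- The self-adjoint operator `|ψ 0⟩⟨ψ 0| ⊗ ⋯ ⊗ |ψ (N-1)⟩⟨ψ (N-1)|`. -/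
noncomputable def productProjector (ψ : ∀ k, EuclideanSpace ℂ (Fin (d k))) : HermOp d :=
  ⟨tensorOp fun k => ketBra (ψ k), isSelfAdjoint_tensorOp_ketBra ψ⟩

/-- The set `𝐏` of pure product states: tensor products of one-dimensional projectors. -/
def pureProductStates (d : Fin N → ℕ) : Set (HermOp d) :=
  {P | ∃ ψ : ∀ k, EuclideanSpace ℂ (Fin (d k)), (∀ k, ‖ψ k‖ = 1) ∧ P = productProjector ψ}

/-- The set of separable density operators: the convex hull of the pure product states. -/
def separableStates (d : Fin N → ℕ) : Set (HermOp d) :=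
  convexHull ℝ (pureProductStates d)

/-- The self-adjoint operators with trace one. All density operators lie in this hyperplane. -/
abbrev TraceOne (d : Fin N → ℕ) : Type := {A : HermOp d // A.toOp.trace = 1}

/-- The interior `𝒟` of the set of separable density operators, taken in the affine space of
self-adjoint operators with trace one (as a set of operators). -/
def separableInterior (d : Fin N → ℕ) : Set (HermOp d) :=
  Subtype.val '' interior {A : TraceOne d | A.1 ∈ separableStates d}

/-- The set `𝒩` of traceless self-adjoint operators. -/
def tracelessOps (d : Fin N → ℕ) : Set (HermOp d) := {A | A.toOp.trace = 0}

end ProductStates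

section InvariantMeasure

variable {N : ℕ} {d : Fin N → ℕ}

/-- The group of local unitary transformations `U = U 0 ⊗ ⋯ ⊗ U (N-1)`, given by the families of
unitary operators on the factors. -/
abbrev LocalUnitary (d : Fin N → ℕ) : Type := ∀ k, Matrix.unitaryGroup (Fin (d k)) ℂ

theorem isSelfAdjoint_localConj (U : LocalUnitary d) (A : HermOp d) :
    IsSelfAdjoint (tensorOp (fun k => (U k).1) * A.toOp * (tensorOp fun k => (U k).1)ᴴ) := by
  change (_)ᴴ = _
  simp only [Matrix.conjTranspose_mul, Matrix.conjTranspose_conjTranspose, A.conjTranspose_toOp,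
    Matrix.mul_assoc]

/-- The action `A ↦ U A U*` of a local unitary transformation on self-adjoint operators. -/
noncomputable def localConj (U : LocalUnitary d) (A : HermOp d) : HermOp d :=
  ⟨_, isSelfAdjoint_localConj U A⟩

/-- The unitary group `U(n)` acting on vectors of `ℂ^n`. -/
noncomputable def applyUnitary {n : ℕ} (U : Matrix.unitaryGroup (Fin n) ℂ)
    (ψ : EuclideanSpace ℂ (Fin n)) : EuclideanSpace ℂ (Fin n) :=
  WithLp.toLp 2 (U.1 *ᵥ ψ.ofLp)

theorem norm_applyUnitary {n : ℕ} (U : Matrix.unitaryGroup (Fin n) ℂ)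
    (ψ : EuclideanSpace ℂ (Fin n)) : ‖applyUnitary U ψ‖ = ‖ψ‖ := by
  have h : ∀ v : EuclideanSpace ℂ (Fin n), ((‖v‖ ^ 2 : ℝ) : ℂ) = star v.ofLp ⬝ᵥ v.ofLp := by
    intro v
    rw [EuclideanSpace.norm_sq_eq]
    simp [dotProduct, Complex.conj_mul']
  have h2 : ((‖applyUnitary U ψ‖ ^ 2 : ℝ) : ℂ) = ((‖ψ‖ ^ 2 : ℝ) : ℂ) := by
    rw [h, h, applyUnitary, Matrix.star_mulVec, Matrix.dotProduct_mulVec, Matrix.vecMul_vecMul]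
    have : U.1ᴴ * U.1 = 1 := Matrix.mem_unitaryGroup_iff'.mp U.2
    rw [this, Matrix.vecMul_one]
  have h3 : ‖applyUnitary U ψ‖ ^ 2 = ‖ψ‖ ^ 2 := by exact_mod_cast h2
  exact (sq_eq_sq₀ (norm_nonneg _) (norm_nonneg _)).mp h3

theorem localConj_productProjector (U : LocalUnitary d) (ψ : ∀ k, EuclideanSpace ℂ (Fin (d k))) :
    localConj U (productProjector ψ) = productProjector fun k => applyUnitary (U k) (ψ k) := by
  refine HermOp.ext_toOp ?_
  change tensorOp (fun k => (U k).1) * tensorOp (fun k => ketBra (ψ k)) *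
    (tensorOp fun k => (U k).1)ᴴ = tensorOp fun k => ketBra (applyUnitary (U k) (ψ k))
  rw [conjTranspose_tensorOp, tensorOp_mul, tensorOp_mul]
  congr 1
  funext k
  rw [ketBra_eq_vecMulVec, ketBra_eq_vecMulVec, Matrix.mul_vecMulVec, Matrix.vecMulVec_mul,
    applyUnitary, Matrix.star_mulVec]

theorem localConj_mem (U : LocalUnitary d) {P : HermOp d} (hP : P ∈ pureProductStates d) :
    localConj U P ∈ pureProductStates d := by
  obtain ⟨ψ, hψ, rfl⟩ := hP
  exact ⟨_, fun k => by rw [norm_applyUnitary, hψ k], localConj_productProjector U ψ⟩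

theorem localConj_mul (U V : LocalUnitary d) (A : HermOp d) :
    localConj (U * V) A = localConj U (localConj V A) := by
  refine HermOp.ext_toOp ?_
  change tensorOp (fun k => (U k).1 * (V k).1) * A.toOp *
      (tensorOp fun k => (U k).1 * (V k).1)ᴴ =
    tensorOp (fun k => (U k).1) * (tensorOp (fun k => (V k).1) * A.toOp *
      (tensorOp fun k => (V k).1)ᴴ) * (tensorOp fun k => (U k).1)ᴴ
  rw [← tensorOp_mul, Matrix.conjTranspose_mul]
  simp only [Matrix.mul_assoc]

noncomputable instance : MeasurableSpace (HermOp d) := borel _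

instance : BorelSpace (HermOp d) := ⟨rfl⟩

noncomputable instance : MeasurableSpace (LocalUnitary d) := borel _

instance : BorelSpace (LocalUnitary d) := ⟨rfl⟩

instance (n : ℕ) : CompactSpace (Matrix.unitaryGroup (Fin n) ℂ) := by
  refine isCompact_iff_compactSpace.mp ?_
  have hK : IsCompact (Set.univ.pi fun _ : Fin n => Set.univ.pi fun _ : Fin n =>
      Metric.closedBall (0 : ℂ) 1) :=
    isCompact_univ_pi fun _ => isCompact_univ_pi fun _ => isCompact_closedBall 0 1
  refine IsCompact.of_isClosed_subset hK
    (isClosed_unitary (R := Matrix (Fin n) (Fin n) ℂ)) fun U hU => ?_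
  intro i _ j _
  simpa using entry_norm_bound_of_unitary hU i j

/-- The reference pure product state `P₀ = |e₀ ⊗ ⋯ ⊗ e₀⟩⟨e₀ ⊗ ⋯ ⊗ e₀|`. -/
noncomputable def refState (d : Fin N → ℕ) [∀ k, NeZero (d k)] : HermOp d :=
  productProjector fun k => EuclideanSpace.single (0 : Fin (d k)) 1

theorem refState_mem (d : Fin N → ℕ) [∀ k, NeZero (d k)] : refState d ∈ pureProductStates d :=
  ⟨_, fun k => by simp, rfl⟩

/-- The map `U ↦ U P₀ U*` from local unitary transformations onto the pure product states. -/
noncomputable def orbitMap (d : Fin N → ℕ) [∀ k, NeZero (d k)] (U : LocalUnitary d) :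
    pureProductStates d :=
  ⟨localConj U (refState d), localConj_mem U (refState_mem d)⟩

theorem continuous_orbitMap (d : Fin N → ℕ) [∀ k, NeZero (d k)] : Continuous (orbitMap d) := by
  refine Continuous.subtype_mk ?_ _
  refine continuous_hermOp_iff.mpr ?_
  have h : Continuous fun U : LocalUnitary d => (tensorOp fun k => (U k).1 : ProdOp d) := by
    refine continuous_matrix fun i j => ?_
    simp only [tensorOp, Matrix.of_apply]
    exact continuous_finsetProd _ fun k _ =>
      (continuous_subtype_val.comp (continuous_apply k)).matrix_elem _ _
  exact (h.mul continuous_const).mul h.matrix_conjTranspose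

/-- The local-unitary-invariant probability measure `σ` on the set of pure product states: the law
of `U P₀ U*` when the local unitary transformation `U` is distributed by the Haar probability
measure. -/
noncomputable def sigmaMeasure (d : Fin N → ℕ) [∀ k, NeZero (d k)] :
    Measure (pureProductStates d) :=
  (Measure.haarMeasure (⊤ : TopologicalSpace.PositiveCompacts (LocalUnitary d))).map (orbitMap d)

instance (d : Fin N → ℕ) [∀ k, NeZero (d k)] : IsProbabilityMeasure (sigmaMeasure d) := by
  have : IsProbabilityMeasure
      (Measure.haarMeasure (⊤ : TopologicalSpace.PositiveCompacts (LocalUnitary d))) := by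
    refine ⟨?_⟩
    rw [← TopologicalSpace.PositiveCompacts.coe_top]
    exact Measure.haarMeasure_self
  exact Measure.isProbabilityMeasure_map (continuous_orbitMap d).measurable.aemeasurable

/-- The action of a local unitary transformation on the pure product states. -/
noncomputable def localAct (U : LocalUnitary d) (P : pureProductStates d) : pureProductStates d :=
  ⟨localConj U P.1, localConj_mem U P.2⟩

theorem continuous_localAct (U : LocalUnitary d) : Continuous (localAct U) := by
  refine Continuous.subtype_mk ?_ _
  refine continuous_hermOp_iff.mpr ?_
  have h : Continuous fun P : pureProductStates d => P.1.toOp :=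
    HermOp.continuous_toOp.comp continuous_subtype_val
  exact (continuous_const.mul h).mul continuous_const

theorem map_localAct_sigmaMeasure [∀ k, NeZero (d k)] (U : LocalUnitary d) :
    (sigmaMeasure d).map (localAct U) = sigmaMeasure d := by
  have h : localAct U ∘ orbitMap d = orbitMap d ∘ fun V => U * V := by
    funext V
    exact Subtype.ext (localConj_mul U V (refState d)).symm
  have hU : Measurable fun V : LocalUnitary d => U * V := (continuous_const_mul U).measurable
  rw [sigmaMeasure, Measure.map_map (continuous_localAct U).measurable
    (continuous_orbitMap d).measurable, h,
    ← Measure.map_map (continuous_orbitMap d).measurable hU, map_mul_left_eq_self]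

end InvariantMeasure

/-- The function `W(X) = ln ∫_𝐏 e^{tr(XP)} dσ(P)` on self-adjoint operators. -/
noncomputable def husimiW {N : ℕ} (d : Fin N → ℕ) [∀ k, NeZero (d k)] (X : HermOp d) : ℝ :=
  Real.log (∫ P : pureProductStates d, Real.exp (trMul X P.1) ∂(sigmaMeasure d))

/-- The gradient map `χ = ∇W`, for the inner product `tr (A B)`. -/
noncomputable def husimiChi {N : ℕ} (d : Fin N → ℕ) [∀ k, NeZero (d k)] (X : HermOp d) : HermOp d :=
  ∇ (husimiW d) X

section Diffeomorphisms

variable {E F : Type*} [NormedAddCommGroup E] [NormedSpace ℝ E]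
  [NormedAddCommGroup F] [NormedSpace ℝ F]

/-- `f` is smooth on an arbitrary subset `S` of a normed space: near each point of `S` it coincides
on `S` with a function that is `C^∞` on an open set. -/
def SmoothOnSubset (f : E → F) (S : Set E) : Prop :=
  ∀ x ∈ S, ∃ U : Set E, IsOpen U ∧ x ∈ U ∧ ∃ f' : E → F, ContDiffOn ℝ ∞ f' U ∧ Set.EqOn f f' (S ∩ U)

/-- `f` restricts to a diffeomorphism of `S` onto `T`: a bijection of `S` onto `T`, smooth on `S`,
whose inverse is smooth on `T`. -/
def IsDiffeoOnto (f : E → F) (S : Set E) (T : Set F) : Prop :=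
  Set.BijOn f S T ∧ SmoothOnSubset f S ∧
    ∃ g : F → E, Set.InvOn g f S T ∧ SmoothOnSubset g T

end Diffeomorphisms

/-!
The function `W` is the logarithmic moment generating function of the probability measure `σ`, whose
support is the compact set `𝐏`, so the theorem is an instance of a general fact on exponential
families. Let `μ` be a probability measure of full support on a compact set `K` in a
finite-dimensional inner product space, and assume that `K` lies in a hyperplane `⟪·, e⟫ = 1` and
spans the space. Then the gradient of `W(X) = ln ∫ e^{⟪X, p⟫} dμ(p)` is a diffeomorphism of the
orthogonal complement of `e` onto the interior of the convex hull of `K` relative to the hyperplane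
(`isDiffeoOnto_gradient_logMoment`).

* Smoothness: `∫ g(p) e^{⟪X, p⟫} dμ(p)` is a continuous linear functional of the exponential of a
  linear function of `X` in the Banach algebra `C(K, ℝ)` (`expMoment_eq`).
* The Hessian of `W` in the direction `Y` is the variance of `⟪Y, ·⟫` under the measure with density
  proportional to `e^{⟪X, ·⟫}`. It vanishes only for multiples `Y` of `e`. Adding `⟪X, e⟫ e` to the
  gradient thus gives a map `augGradient` on the whole space with positive definite derivative
  (`hasDerivAt_inner_augGradient_line`), which is injective and a local diffeomorphism, and agrees
  with the gradient on the orthogonal complement of `e`.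
* The gradient is a barycentre of `K`, hence lies in the convex hull, which is compact by
  Carathéodory's theorem. As `augGradient` is open, it lies in the relative interior
  (`gradient_logMoment_mem_hullInterior`).
* For `ρ` in the relative interior, `W(X) - ⟪X, ρ⟫` is coercive on the orthogonal complement of `e`
  (`exists_le_logMoment_sub_inner`) and invariant under translations by multiples of `e`, so it has
  a global minimum, where the gradient of `W` is `ρ` (`exists_gradient_logMoment_eq`).

For pure product states, `e` is the identity operator. The measure `σ` has full support because the
unitary groups act transitively on unit vectors (`surjective_orbitMap`), and the pure product states
span the self-adjoint operators by polarization in each factor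
(`eq_zero_of_inner_pureProductStates`).
-/

set_option linter.unusedSectionVars false

/-! ### Convex hulls of compact sets in finite dimension -/

/-- By Carathéodory's theorem, the convex hull of a compact set `K` in dimension `n` is the image
of the compact set `stdSimplex × Kⁿ⁺¹` under `(w, z) ↦ ∑ wᵢ zᵢ`. -/
theorem IsCompact.convexHull_of_finiteDimensional {E : Type*} [NormedAddCommGroup E]
    [NormedSpace ℝ E] [FiniteDimensional ℝ E] {K : Set E} (hK : IsCompact K) :
    IsCompact (convexHull ℝ K) := by
  let ι := Fin (Module.finrank ℝ E + 1)
  have h1 : IsCompact ((fun q : (ι → ℝ) × (ι → E) => ∑ i, q.1 i • q.2 i) ''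
      (stdSimplex ℝ ι ×ˢ Set.univ.pi fun _ => K)) :=
    ((isCompact_stdSimplex ℝ ι).prod (isCompact_univ_pi fun _ => hK)).image (by fun_prop)
  convert h1 using 1
  refine Set.Subset.antisymm (fun x hx => ?_) ?_
  · obtain ⟨κ, _, z, w, hz, hind, hw, hsum, rfl⟩ := eq_pos_convex_span_of_mem_convexHull hx
    have hcard : Fintype.card κ ≤ Fintype.card ι := by
      rw [Fintype.card_fin]
      exact hind.card_le_finrank_succ.trans (Nat.succ_le_succ (Submodule.finrank_le _))
    obtain ⟨e⟩ := Function.Embedding.nonempty_of_card_le hcard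
    have hne : Nonempty κ := by
      by_contra h
      rw [not_nonempty_iff] at h
      simp at hsum
    obtain ⟨k₀⟩ := hne
    have hout : ∀ i ∉ Set.range e, Function.extend e w 0 i = 0 := fun i hi => by
      rw [Function.extend_apply' _ _ _ (by simpa using hi)]
      rfl
    refine ⟨(Function.extend e w 0, Function.extend e z fun _ => z k₀), ⟨⟨fun i => ?_, ?_⟩,
      fun i _ => ?_⟩, ?_⟩
    · by_cases hi : i ∈ Set.range e
      · obtain ⟨k, rfl⟩ := hi
        simpa [e.injective.extend_apply] using (hw k).le
      · exact (hout i hi).ge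
    · rw [← hsum]
      exact (Fintype.sum_of_injective e e.injective w _ hout
        fun k => (e.injective.extend_apply _ _ _).symm).symm
    · by_cases hi : i ∈ Set.range e
      · obtain ⟨k, rfl⟩ := hi
        simpa [e.injective.extend_apply] using hz ⟨k, rfl⟩
      · dsimp only
        rw [Function.extend_apply' _ _ _ (by simpa using hi)]
        exact hz ⟨k₀, rfl⟩
    · refine (Fintype.sum_of_injective e e.injective _ _ (fun i hi => ?_) fun k => ?_).symm
      · dsimp only
        rw [hout i hi, zero_smul]
      · simp [e.injective.extend_apply]
  · rintro _ ⟨⟨w, z⟩, ⟨hw, hz⟩, rfl⟩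
    exact (convex_convexHull ℝ K).sum_mem (fun i _ => hw.1 i) hw.2
      fun i _ => subset_convexHull ℝ K (hz i trivial)

/-! ### Exponential moments of a probability measure on a compact set -/

theorem integrable_continuousMap {α : Type*} [TopologicalSpace α] [CompactSpace α]
    [MeasurableSpace α] [OpensMeasurableSpace α] (μ : Measure α) [IsFiniteMeasure μ] (f : C(α, ℝ)) :
    Integrable f μ :=
  f.continuous.integrable_of_hasCompactSupport (HasCompactSupport.of_compactSpace _)

section ExponentialFamily

variable {E : Type*} [NormedAddCommGroup E] [InnerProductSpace ℝ E] [FiniteDimensional ℝ E]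
  {K : Set E}

/-- The restriction to `K` of the linear function `⟪X, ·⟫`, as a linear function of `X` with values
in the Banach algebra of continuous functions on `K`. -/
noncomputable def pairing [CompactSpace K] : E →L[ℝ] C(K, ℝ) :=
  LinearMap.toContinuousLinearMap
    { toFun := fun X => ⟨fun p => inner ℝ X p.1, by fun_prop⟩
      map_add' := fun X Y => by ext p; simp [inner_add_left]
      map_smul' := fun r X => by ext p; simp [inner_smul_left] }

@[simp] theorem pairing_apply [CompactSpace K] (X : E) (p : K) :
    pairing X p = inner ℝ X p.1 := rfl

variable [MeasurableSpace E] [BorelSpace E]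

/-- Integration of continuous functions on `K`, as a continuous linear functional. -/
noncomputable def integralFunctional [CompactSpace K] (μ : Measure K) [IsProbabilityMeasure μ] :
    C(K, ℝ) →L[ℝ] ℝ :=
  LinearMap.mkContinuous
    { toFun := fun f => ∫ p, f p ∂μ
      map_add' := fun f g =>
        integral_add (integrable_continuousMap μ f) (integrable_continuousMap μ g)
      map_smul' := fun r f => integral_const_mul r _ } 1
    fun f => by
      simpa using norm_integral_le_of_norm_le_const (μ := μ) (f := f)
        (Filter.Eventually.of_forall f.norm_coe_le_norm)

/-- The exponential moment `∫ g(p) e^{⟪X, p⟫} dμ(p)`. -/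
noncomputable def expMoment (μ : Measure K) (g : K → ℝ) (X : E) : ℝ :=
  ∫ p, g p * Real.exp (inner ℝ X p.1) ∂μ

/-- The logarithm of the moment generating function, `W(X) = ln ∫ e^{⟪X, p⟫} dμ(p)`. -/
noncomputable def logMoment (μ : Measure K) (X : E) : ℝ :=
  Real.log (∫ p : K, Real.exp (inner ℝ X p.1) ∂μ)

variable [CompactSpace K] (μ : Measure K) [IsProbabilityMeasure μ]

theorem exp_pairing_apply (X : E) (p : K) :
    NormedSpace.exp (pairing X : C(K, ℝ)) p = Real.exp (inner ℝ X p.1) := by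
  have h := NormedSpace.map_exp (ContinuousMap.evalAlgHom ℝ ℝ p)
    (continuous_eval_const p) (pairing X)
  rw [Real.exp_eq_exp_ℝ]
  exact h

/-- An exponential moment is a continuous linear functional of the exponential function of a Banach
algebra, evaluated at a linear function of `X`. -/
theorem expMoment_eq (g : C(K, ℝ)) (X : E) :
    expMoment μ g X = integralFunctional μ (g * NormedSpace.exp (pairing X)) := by
  change _ = ∫ p, (g * NormedSpace.exp (pairing X) : C(K, ℝ)) p ∂μ
  simp only [ContinuousMap.mul_apply, exp_pairing_apply]
  rfl

theorem contDiff_expMoment (g : C(K, ℝ)) : ContDiff ℝ ∞ (expMoment μ g : E → ℝ) := by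
  have h : ContDiff ℝ ∞ (NormedSpace.exp : C(K, ℝ) → C(K, ℝ)) :=
    contDiff_iff_contDiffAt.mpr fun x => (NormedSpace.exp_analytic (𝕂 := ℝ) x).contDiffAt
  simp only [funext (expMoment_eq μ g)]
  exact (integralFunctional μ).contDiff.comp
    (contDiff_const.mul (h.comp (pairing (K := K) (E := E)).contDiff))

theorem fderiv_expMoment (g : C(K, ℝ)) (X Y : E) :
    fderiv ℝ (expMoment μ g) X Y = expMoment μ (g * pairing Y : C(K, ℝ)) X := by
  have h := ((integralFunctional μ).hasFDerivAt.comp X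
    (((hasFDerivAt_exp (𝕂 := ℝ) (x := (pairing X : C(K, ℝ)))).comp X
      (pairing (K := K)).hasFDerivAt).const_mul g))
  rw [show expMoment μ g = _ from funext (expMoment_eq μ g)]
  refine (DFunLike.congr_fun h.fderiv Y).trans ?_
  rw [expMoment_eq]
  change integralFunctional μ (g * (NormedSpace.exp (pairing X) * pairing Y)) = _
  congr 1
  ring

theorem hasDerivAt_expMoment_line (g : C(K, ℝ)) (X Y : E) (t : ℝ) :
    HasDerivAt (fun s : ℝ => expMoment μ g (X + s • Y))
      (expMoment μ (g * pairing Y : C(K, ℝ)) (X + t • Y)) t := by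
  rw [← fderiv_expMoment]
  have h1 : HasDerivAt (fun s : ℝ => X + s • Y) Y t := by
    simpa using ((hasDerivAt_id t).smul_const Y).const_add X
  exact (((contDiff_expMoment μ g).differentiable (by simp)) _).hasFDerivAt.comp_hasDerivAt t h1

end ExponentialFamily

/-! ### The gradient of the logarithmic moment generating function -/

section LogMoment

variable {E : Type*} [NormedAddCommGroup E] [InnerProductSpace ℝ E] [FiniteDimensional ℝ E]
  {K : Set E} [MeasurableSpace E] [BorelSpace E] [CompactSpace K] (μ : Measure K)
  [IsProbabilityMeasure μ]

theorem expMoment_one_pos (X : E) : 0 < expMoment μ (1 : C(K, ℝ)) X := by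
  have h : Integrable (fun p : K => Real.exp (inner ℝ X p.1)) μ :=
    integrable_continuousMap μ ⟨fun p => Real.exp (inner ℝ X p.1), by fun_prop⟩
  simpa [expMoment] using integral_exp_pos h

theorem logMoment_eq_log (X : E) : logMoment μ X = Real.log (expMoment μ (1 : C(K, ℝ)) X) := by
  simp [logMoment, expMoment]

theorem contDiff_logMoment : ContDiff ℝ ∞ (logMoment μ : E → ℝ) := by
  rw [funext (logMoment_eq_log μ)]
  exact (contDiff_expMoment μ 1).log fun X => (expMoment_one_pos μ X).ne'

theorem inner_gradient_logMoment (X Y : E) :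
    inner ℝ (∇ (logMoment μ) X) Y =
      expMoment μ (pairing Y : C(K, ℝ)) X / expMoment μ (1 : C(K, ℝ)) X := by
  have h1 : inner ℝ (∇ (logMoment μ) X) Y = fderiv ℝ (logMoment μ) X Y := by
    rw [← toDual_gradient, InnerProductSpace.toDual_apply_apply]
  have h2 := (((contDiff_expMoment μ (1 : C(K, ℝ))).differentiable (by simp)) X).hasFDerivAt.log
    (expMoment_one_pos μ X).ne'
  rw [h1, funext (logMoment_eq_log μ), h2.fderiv]
  simp only [_root_.smul_apply, fderiv_expMoment, one_mul, smul_eq_mul]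
  ring

theorem contDiff_gradient_logMoment : ContDiff ℝ ∞ (∇ (logMoment μ) : E → E) := by
  have h : ContDiff ℝ ∞ (fderiv ℝ (logMoment μ : E → ℝ)) :=
    (contDiff_logMoment μ).fderiv_right (by simp)
  exact (InnerProductSpace.toDual ℝ E).symm.contDiff.comp h

/-- The gradient at `X` is the barycentre of the probability measure with density proportional to
`e^{⟪X, p⟫}`, hence lies in the convex hull of `K`. -/
theorem gradient_logMoment_mem_convexHull (X : E) : ∇ (logMoment μ) X ∈ convexHull ℝ K := by
  have hexp : Integrable (fun p : K => Real.exp (inner ℝ X p.1)) μ :=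
    integrable_continuousMap μ ⟨fun p => Real.exp (inner ℝ X p.1), by fun_prop⟩
  have := isProbabilityMeasure_tilted hexp
  set ν := μ.tilted fun p => inner ℝ X p.1
  have hint : Integrable (fun p : K => p.1) ν :=
    continuous_subtype_val.integrable_of_hasCompactSupport (HasCompactSupport.of_compactSpace _)
  have hK : IsClosed (convexHull ℝ K) :=
    (isCompact_iff_compactSpace.mpr ‹_›).convexHull_of_finiteDimensional.isClosed
  have hmem := (convex_convexHull ℝ K).integral_mem (μ := ν) hK
    (Filter.Eventually.of_forall fun p : K => subset_convexHull ℝ K p.2) hint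
  convert hmem using 1
  refine ext_inner_right ℝ fun Y => ?_
  rw [inner_gradient_logMoment, real_inner_comm, ← integral_inner hint, integral_tilted]
  simp only [expMoment, pairing_apply, ContinuousMap.one_apply, one_mul, smul_eq_mul]
  rw [← integral_div]
  refine integral_congr_ae (Filter.Eventually.of_forall fun p => ?_)
  dsimp only
  ring

theorem expMoment_nonneg {g : C(K, ℝ)} (hg : ∀ p, 0 ≤ g p) (X : E) : 0 ≤ expMoment μ g X :=
  integral_nonneg fun p => mul_nonneg (hg p) (Real.exp_pos _).le

theorem expMoment_pos [μ.IsOpenPosMeasure] {g : C(K, ℝ)} (hg : ∀ p, 0 ≤ g p) {p₀ : K}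
    (h : g p₀ ≠ 0) (X : E) : 0 < expMoment μ g X := by
  have hc : Continuous fun p : K => g p * Real.exp (inner ℝ X p.1) := by fun_prop
  exact integral_pos_of_integrable_nonneg_nonzero hc (integrable_continuousMap μ ⟨_, hc⟩)
    (fun p => mul_nonneg (hg p) (Real.exp_pos _).le) (mul_ne_zero h (Real.exp_pos _).ne')

/-- The map `X ↦ ∇W(X) + ⟪X, e⟫ e`, for `W` the logarithmic moment generating function. If `K` lies
in the hyperplane `⟪·, e⟫ = 1`, then `W` is affine in the direction of `e`; the added term makes the
derivative invertible there, and it vanishes on the orthogonal complement of `e`. -/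
noncomputable def augGradient (e X : E) : E := ∇ (logMoment μ) X + inner ℝ X e • e

theorem contDiff_augGradient (e : E) : ContDiff ℝ ∞ (augGradient μ e) :=
  (contDiff_gradient_logMoment μ).add ((contDiff_id.inner ℝ contDiff_const).smul contDiff_const)

variable {e : E} [μ.IsOpenPosMeasure]

/-- The second derivative of `W(X) + ⟪X, e⟫² / 2` in the direction `Y` is a variance plus
`⟪Y, e⟫²`. The variance vanishes only if `⟪Y, ·⟫` is constant on `K`, that is, if `Y` is a multiple
of `e`. -/
theorem hasDerivAt_inner_augGradient_line (he : ∀ p : K, inner ℝ p.1 e = 1)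
    (hsep : ∀ Y : E, (∀ p : K, inner ℝ Y p.1 = 0) → Y = 0) (X : E) {Y : E} (hY : Y ≠ 0) (t : ℝ) :
    ∃ v > 0, HasDerivAt (fun s : ℝ => inner ℝ (augGradient μ e (X + s • Y)) Y) v t := by
  set Z := X + t • Y with hZ
  have hM := expMoment_one_pos μ Z
  have hd := ((hasDerivAt_expMoment_line μ (pairing Y) X Y t).div
    (hasDerivAt_expMoment_line μ 1 X Y t) hM.ne').add
    ((((hasDerivAt_id t).smul_const Y).const_add X).inner ℝ (hasDerivAt_const t e)
      |>.mul_const (inner ℝ e Y))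
  refine ⟨_, ?_, hd.congr_of_eventuallyEq (Filter.Eventually.of_forall fun s => ?_)⟩
  · set m := expMoment μ (pairing Y : C(K, ℝ)) Z / expMoment μ (1 : C(K, ℝ)) Z with hm
    -- The expectation of `g` under the tilted measure is the variance of `⟪Y, ·⟫`.
    set g : C(K, ℝ) := (pairing Y - m • 1) * (pairing Y - m • 1) with hg
    have hg0 : ∀ p, 0 ≤ g p := fun p => mul_self_nonneg _
    have hvar : expMoment μ g Z = expMoment μ (pairing Y * pairing Y : C(K, ℝ)) Z -
        2 * m * expMoment μ (pairing Y : C(K, ℝ)) Z + m ^ 2 * expMoment μ (1 : C(K, ℝ)) Z := by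
      have : g = pairing Y * pairing Y - (2 * m) • pairing Y + m ^ 2 • 1 := by
        ext p
        simp [hg]
        ring
      rw [this]
      simp only [expMoment_eq, add_mul, sub_mul, smul_mul_assoc, map_add, map_sub, map_smul,
        smul_eq_mul]
    have hv : 0 < expMoment μ g Z / expMoment μ (1 : C(K, ℝ)) Z + inner ℝ Y e ^ 2 := by
      by_cases h : ∀ p : K, inner ℝ Y p.1 = m
      · have hYe : Y = m • e := by
          refine sub_eq_zero.mp (hsep _ fun p => ?_)
          rw [inner_sub_left, h, inner_smul_left, real_inner_comm, he]
          simp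
        have hmne : m ≠ 0 := fun h0 => hY (by rw [hYe, h0, zero_smul])
        have hene : e ≠ 0 := fun h0 => hY (by rw [hYe, h0, smul_zero])
        have hne : inner ℝ Y e ≠ 0 := by
          rw [hYe, inner_smul_left]
          exact mul_ne_zero hmne (inner_self_ne_zero.mpr hene)
        exact add_pos_of_nonneg_of_pos (div_nonneg (expMoment_nonneg μ hg0 Z) hM.le) (by positivity)
      · push Not at h
        obtain ⟨p, hp⟩ := h
        refine add_pos_of_pos_of_nonneg (div_pos (expMoment_pos μ hg0 (p₀ := p) ?_ Z) hM)
          (sq_nonneg _)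
        have : inner ℝ Y p.1 - m ≠ 0 := sub_ne_zero.mpr hp
        simpa [hg] using this
    convert hv using 1
    rw [hvar, hm]
    have := hM.ne'
    simp only [one_smul, inner_zero_right, zero_add, one_mul, real_inner_comm Y e, id, ← hZ]
    field_simp
    ring
  · simp only [augGradient, inner_add_left _ _ Y, inner_gradient_logMoment, inner_smul_left,
      Pi.add_apply, Pi.div_apply, id]
    rfl

theorem augGradient_injective (he : ∀ p : K, inner ℝ p.1 e = 1)
    (hsep : ∀ Y : E, (∀ p : K, inner ℝ Y p.1 = 0) → Y = 0) :
    Function.Injective (augGradient μ e) := by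
  intro X X' h
  by_contra hne
  have hY : X' - X ≠ 0 := sub_ne_zero.mpr (Ne.symm hne)
  have hmono : StrictMono fun s : ℝ => inner ℝ (augGradient μ e (X + s • (X' - X))) (X' - X) :=
    strictMono_of_deriv_pos fun t => by
      obtain ⟨v, hv, hd⟩ := hasDerivAt_inner_augGradient_line μ he hsep X hY t
      rwa [hd.deriv]
  have := hmono zero_lt_one
  simp [h] at this

theorem exists_equiv_hasFDerivAt_augGradient (he : ∀ p : K, inner ℝ p.1 e = 1)
    (hsep : ∀ Y : E, (∀ p : K, inner ℝ Y p.1 = 0) → Y = 0) (X : E) :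
    ∃ f' : E ≃L[ℝ] E, HasFDerivAt (augGradient μ e) (f' : E →L[ℝ] E) X := by
  have hd := (((contDiff_augGradient μ e).differentiable (by simp)) X).hasFDerivAt
  set L := fderiv ℝ (augGradient μ e) X
  have hinj : Function.Injective L := by
    refine (injective_iff_map_eq_zero L).mpr fun Y hLY => ?_
    by_contra hY
    obtain ⟨v, hv, hv'⟩ := hasDerivAt_inner_augGradient_line μ he hsep X hY 0
    have hd' : HasFDerivAt (augGradient μ e) L (X + (0 : ℝ) • Y) := by simpa using hd
    have hline : HasDerivAt (fun s : ℝ => X + s • Y) Y 0 := by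
      simpa using ((hasDerivAt_id (0 : ℝ)).smul_const Y).const_add X
    have h2 := (hd'.comp_hasDerivAt 0 hline).inner ℝ (hasDerivAt_const (0 : ℝ) Y)
    have h3 := hv'.unique h2
    simp [hLY] at h3
    exact hv.ne' h3
  refine ⟨(LinearEquiv.ofInjectiveEndo (L : E →ₗ[ℝ] E) hinj).toContinuousLinearEquiv, ?_⟩
  convert hd using 1
  ext Y
  rfl

end LogMoment

/-! ### The gradient map as a diffeomorphism onto the relative interior of the convex hull -/

/-- The interior of the convex hull of `K` relative to the hyperplane `⟪·, e⟫ = 1`. -/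
def hullInterior {E : Type*} [NormedAddCommGroup E] [InnerProductSpace ℝ E] (K : Set E) (e : E) :
    Set E :=
  {A | inner ℝ A e = 1 ∧ ∃ ε > 0, ∀ B : E, inner ℝ B e = 1 → dist B A < ε → B ∈ convexHull ℝ K}

section Diffeomorphism

variable {E : Type*} [NormedAddCommGroup E] [InnerProductSpace ℝ E] [FiniteDimensional ℝ E]
  {K : Set E} [MeasurableSpace E] [BorelSpace E] [CompactSpace K] (μ : Measure K)
  [IsProbabilityMeasure μ] {e : E}

theorem inner_gradient_logMoment_normal (he : ∀ p : K, inner ℝ p.1 e = 1) (X : E) :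
    inner ℝ (∇ (logMoment μ) X) e = 1 := by
  have h : (pairing e : C(K, ℝ)) = 1 := by
    ext p
    rw [pairing_apply, real_inner_comm, he]
    rfl
  rw [inner_gradient_logMoment, h, div_self (expMoment_one_pos μ X).ne']

theorem logMoment_add_smul (he : ∀ p : K, inner ℝ p.1 e = 1) (X : E) (c : ℝ) :
    logMoment μ (X + c • e) = logMoment μ X + c := by
  have h : ∀ p : K, Real.exp (inner ℝ (X + c • e) p.1) =
      Real.exp (inner ℝ X p.1) * Real.exp c := fun p => by
    rw [← Real.exp_add, inner_add_left, real_inner_smul_left, real_inner_comm p.1 e,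
      he, mul_one]
  have hM := expMoment_one_pos μ X
  simp only [expMoment, ContinuousMap.one_apply, one_mul] at hM
  simp only [logMoment, h]
  rw [integral_mul_const, Real.log_mul hM.ne' (Real.exp_pos c).ne', Real.log_exp]

theorem inner_augGradient_normal (he : ∀ p : K, inner ℝ p.1 e = 1) (X : E) :
    inner ℝ (augGradient μ e X) e = 1 + inner ℝ X e * inner ℝ e e := by
  rw [augGradient, inner_add_left, inner_gradient_logMoment_normal μ he, inner_smul_left]
  simp

theorem augGradient_of_orthogonal {X : E} (hX : inner ℝ X e = 0) :
    augGradient μ e X = ∇ (logMoment μ) X := by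
  rw [augGradient, hX, zero_smul, add_zero]

variable [μ.IsOpenPosMeasure]

/-- Since `X ↦ ∇W(X) + ⟪X, e⟫ e` is an open map, its image contains a neighbourhood of `∇W(X)`; the
points of the hyperplane `⟪·, e⟫ = 1` in it are gradients of `W`, hence in the convex hull. -/
theorem gradient_logMoment_mem_hullInterior (he : ∀ p : K, inner ℝ p.1 e = 1) (hne : e ≠ 0)
    (hsep : ∀ Y : E, (∀ p : K, inner ℝ Y p.1 = 0) → Y = 0) {X : E} (hX : inner ℝ X e = 0) :
    ∇ (logMoment μ) X ∈ hullInterior K e := by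
  refine ⟨inner_gradient_logMoment_normal μ he X, ?_⟩
  obtain ⟨f', hf'⟩ := exists_equiv_hasFDerivAt_augGradient μ he hsep X
  have hstrict := (contDiff_augGradient μ e).contDiffAt.hasStrictFDerivAt' hf' (by simp)
  have hnhds : Set.range (augGradient μ e) ∈ nhds (∇ (logMoment μ) X) := by
    rw [← augGradient_of_orthogonal μ hX, ← hstrict.map_nhds_eq_of_equiv]
    exact Filter.range_mem_map
  obtain ⟨ε, hε, hball⟩ := Metric.mem_nhds_iff.mp hnhds
  refine ⟨ε, hε, fun B hB hdist => ?_⟩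
  obtain ⟨X', rfl⟩ := hball hdist
  have hX' : inner ℝ X' e = 0 := by
    rw [inner_augGradient_normal μ he] at hB
    simpa [hne] using hB
  rw [augGradient_of_orthogonal μ hX']
  exact gradient_logMoment_mem_convexHull μ X'

/-- By compactness, the balls of a fixed radius around the points of `K` have measure bounded
below. -/
theorem exists_measureReal_ball_ge {r : ℝ} (hr : 0 < r) :
    ∃ m > 0, ∀ p : K, m ≤ μ.real (Metric.ball p r) := by
  obtain ⟨t, ht⟩ := isCompact_univ.elim_nhds_subcover (fun p : K => Metric.ball p (r / 2))
    fun p _ => Metric.ball_mem_nhds p (by positivity)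
  have hpos : ∀ p : K, 0 < μ.real (Metric.ball p (r / 2)) := fun p =>
    ENNReal.toReal_pos (Metric.measure_ball_pos μ p (by positivity)).ne' (measure_ne_top _ _)
  have hm : ∃ m > 0, ∀ q ∈ t, m ≤ μ.real (Metric.ball q (r / 2)) := by
    rcases t.eq_empty_or_nonempty with rfl | hne
    · exact ⟨1, one_pos, by simp⟩
    · obtain ⟨q, -, hq'⟩ := t.exists_min_image (fun q => μ.real (Metric.ball q (r / 2))) hne
      exact ⟨_, hpos q, hq'⟩
  obtain ⟨m, hm0, hm⟩ := hm
  refine ⟨m, hm0, fun p => ?_⟩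
  obtain ⟨q, hq, hpq⟩ := Set.mem_iUnion₂.mp (ht.2 (Set.mem_univ p))
  refine (hm q hq).trans (measureReal_mono fun x hx => ?_)
  have h1 : dist x q < r / 2 := hx
  have h2 : dist p q < r / 2 := hpq
  have h3 := dist_triangle_right x p q
  rw [Metric.mem_ball]
  linarith

/-- If the convex hull contains the points of the hyperplane at distance at most `2 δ` from `ρ`,
then `K` has a point `p₀` with `⟪X, p₀⟫ ≥ ⟪X, ρ⟫ + 2 δ ‖X‖`. On the ball of radius `δ` around `p₀`, whose
measure is bounded below, `⟪X, ·⟫` is at least `⟪X, ρ⟫ + δ ‖X‖`; hence `W(X) - ⟪X, ρ⟫` is at least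
`δ ‖X‖` plus a constant. -/
theorem exists_le_logMoment_sub_inner {ρ : E} (hρ : ρ ∈ hullInterior K e) :
    ∃ δ > 0, ∃ C : ℝ, ∀ X : E, inner ℝ X e = 0 →
      δ * ‖X‖ + C ≤ logMoment μ X - inner ℝ X ρ := by
  obtain ⟨hρe, ε, hε, hball⟩ := hρ
  set δ := ε / 4 with hδ
  have hδ0 : 0 < δ := by positivity
  obtain ⟨m, hm0, hm⟩ := exists_measureReal_ball_ge μ hδ0
  refine ⟨δ, hδ0, Real.log m, fun X hX => ?_⟩
  -- For `X = 0` this point is `ρ` itself, since `2 * δ / 0 = 0`.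
  have hq : ρ + (2 * δ / ‖X‖) • X ∈ convexHull ℝ K := by
    refine hball _ ?_ ?_
    · rw [inner_add_left, inner_smul_left, hX, hρe, mul_zero, add_zero]
    · rw [dist_eq_norm, add_sub_cancel_left, norm_smul, norm_div, norm_norm, Real.norm_eq_abs,
        abs_of_pos (by positivity : 0 < 2 * δ)]
      rcases eq_or_ne ‖X‖ 0 with h | h
      · rwa [h, mul_zero]
      · rw [div_mul_cancel₀ _ h]
        linarith
  have hp : ∃ p : K, inner ℝ X ρ + 2 * δ * ‖X‖ ≤ inner ℝ X p.1 := by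
    have hconc : ConvexOn ℝ (convexHull ℝ K) fun Y : E => inner ℝ X Y :=
      ((innerₗ E X).convexOn (convex_convexHull ℝ K))
    obtain ⟨p, hpK, hp⟩ := hconc.exists_ge_of_mem_convexHull (subset_convexHull ℝ K) hq
    refine ⟨⟨p, hpK⟩, le_trans (le_of_eq ?_) hp⟩
    rw [inner_add_right, inner_smul_right, real_inner_self_eq_norm_mul_norm]
    rcases eq_or_ne ‖X‖ 0 with h | h
    · simp [h]
    · field_simp
  obtain ⟨p, hp⟩ := hp
  have hc : Continuous fun q : K => Real.exp (inner ℝ X q.1) := by fun_prop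
  have hint : Integrable (fun q : K => Real.exp (inner ℝ X q.1)) μ :=
    integrable_continuousMap μ ⟨_, hc⟩
  have hle : m * Real.exp (inner ℝ X ρ + δ * ‖X‖) ≤ ∫ q : K, Real.exp (inner ℝ X q.1) ∂μ := by
    calc m * Real.exp (inner ℝ X ρ + δ * ‖X‖)
        ≤ μ.real (Metric.ball p δ) * Real.exp (inner ℝ X ρ + δ * ‖X‖) := by gcongr; exact hm p
      _ = ∫ _ in Metric.ball p δ, Real.exp (inner ℝ X ρ + δ * ‖X‖) ∂μ := by simp
      _ ≤ ∫ q in Metric.ball p δ, Real.exp (inner ℝ X q.1) ∂μ := by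
          refine setIntegral_mono_on (integrable_const _).integrableOn hint.integrableOn
            Metric.isOpen_ball.measurableSet fun q hq => Real.exp_le_exp.mpr ?_
          have hdist : ‖p.1 - q.1‖ < δ := by
            rw [← dist_eq_norm, dist_comm]
            exact hq
          have h1 := real_inner_le_norm X (p.1 - q.1)
          rw [inner_sub_right] at h1
          have h2 := mul_le_mul_of_nonneg_left hdist.le (norm_nonneg X)
          linarith
      _ ≤ _ := setIntegral_le_integral hint
          (Filter.Eventually.of_forall fun _ => (Real.exp_pos _).le)
  have hlog := Real.log_le_log (by positivity) hle
  rw [Real.log_mul hm0.ne' (Real.exp_pos _).ne', Real.log_exp] at hlog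
  rw [logMoment]
  linarith

/-- The minimum of the coercive function `W(X) - ⟪X, ρ⟫` on the orthogonal complement of `e` is a
global minimum, because this function is invariant under translations by multiples of `e`. -/
theorem exists_gradient_logMoment_eq (he : ∀ p : K, inner ℝ p.1 e = 1) (hne : e ≠ 0)
    {ρ : E} (hρ : ρ ∈ hullInterior K e) :
    ∃ X : E, inner ℝ X e = 0 ∧ ∇ (logMoment μ) X = ρ := by
  obtain ⟨δ, hδ, C, hC⟩ := exists_le_logMoment_sub_inner μ hρ
  set H : E → ℝ := fun X => logMoment μ X - inner ℝ X ρ with hH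
  have hdiff := (contDiff_logMoment (E := E) μ).differentiable (by simp)
  have hHc : Continuous H := hdiff.continuous.sub (by fun_prop)
  have hclosed : IsClosed {X : E | inner ℝ X e = 0} := isClosed_eq (by fun_prop) continuous_const
  obtain ⟨X, hX, hmin⟩ := hHc.continuousOn.exists_isMinOn' hclosed (x₀ := 0) (by simp) (by
    have hlarge := (tendsto_norm_cocompact_atTop (E := E)).eventually_ge_atTop ((H 0 - C) / δ)
    rw [Filter.eventually_inf_principal]
    filter_upwards [hlarge] with Y hY hYe
    refine le_trans ?_ (hC Y hYe)
    rw [div_le_iff₀ hδ] at hY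
    linarith)
  refine ⟨X, hX, ?_⟩
  have hglob : IsMinOn H Set.univ X := by
    intro Y _
    have hee : inner ℝ e e ≠ (0 : ℝ) := inner_self_ne_zero.mpr hne
    set c : ℝ := inner ℝ Y e / inner ℝ e e with hc
    have hYc : inner ℝ (Y + (-c) • e) e = 0 := by
      rw [inner_add_left, real_inner_smul_left, hc, neg_mul, div_mul_cancel₀ _ hee,
        add_neg_cancel]
    have h1 : H (Y + (-c) • e) = H Y := by
      simp only [hH]
      rw [logMoment_add_smul μ he, inner_add_left, real_inner_smul_left,
        real_inner_comm ρ e, hρ.1]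
      ring
    exact (hmin hYc).trans h1.le
  have hloc : IsLocalMin H X := hglob.isLocalMin Filter.univ_mem
  refine ext_inner_right ℝ fun Y => ?_
  have hd := (hdiff X).hasFDerivAt.sub ((innerSL ℝ ρ).hasFDerivAt (x := X))
  have hd' : HasFDerivAt H (fderiv ℝ (logMoment μ) X - innerSL ℝ ρ) X := by
    refine hd.congr_of_eventuallyEq (Filter.Eventually.of_forall fun Z => ?_)
    simp [hH, real_inner_comm]
  have h0 := DFunLike.congr_fun (hloc.hasFDerivAt_eq_zero hd') Y
  have h1 : inner ℝ (∇ (logMoment μ) X) Y = fderiv ℝ (logMoment μ) X Y := by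
    rw [← toDual_gradient, InnerProductSpace.toDual_apply_apply]
  rw [h1]
  exact sub_eq_zero.mp h0

/-- For a measure of full support on a compact spanning subset of the hyperplane `⟪·, e⟫ = 1`, the
gradient of the logarithmic moment generating function is a diffeomorphism of the orthogonal
complement of `e` onto the relative interior of the convex hull. -/
theorem isDiffeoOnto_gradient_logMoment (he : ∀ p : K, inner ℝ p.1 e = 1) (hne : e ≠ 0)
    (hsep : ∀ Y : E, (∀ p : K, inner ℝ Y p.1 = 0) → Y = 0) :
    IsDiffeoOnto (∇ (logMoment μ)) {X : E | inner ℝ X e = 0} (hullInterior K e) := by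
  have hbij : Set.BijOn (∇ (logMoment μ)) {X : E | inner ℝ X e = 0} (hullInterior K e) := by
    refine ⟨fun X hX => gradient_logMoment_mem_hullInterior μ he hne hsep hX,
      fun X hX X' hX' h => augGradient_injective μ he hsep ?_, fun ρ hρ => ?_⟩
    · rw [augGradient_of_orthogonal μ hX, augGradient_of_orthogonal μ hX', h]
    · exact exists_gradient_logMoment_eq μ he hne hρ
  refine ⟨hbij, fun X _ => ⟨Set.univ, isOpen_univ, trivial, _,
    (contDiff_gradient_logMoment μ).contDiffOn, fun _ _ => rfl⟩, ?_⟩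
  have hinv := hbij.invOn_invFunOn
  refine ⟨_, hinv, fun ρ hρ => ?_⟩
  obtain ⟨X, hX, rfl⟩ := hbij.surjOn hρ
  obtain ⟨f', hf'⟩ := exists_equiv_hasFDerivAt_augGradient μ he hsep X
  have hcd : ContDiffAt ℝ ∞ (augGradient μ e) X := (contDiff_augGradient μ e).contDiffAt
  set Φ := hcd.toOpenPartialHomeomorph _ hf' (by simp) with hΦ
  have hΦX : augGradient μ e X ∈ Φ.target :=
    hcd.image_mem_toOpenPartialHomeomorph_target hf' (by simp)
  have hsmooth : ContDiffOn ℝ ∞ Φ.symm Φ.target := fun A hA => by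
    obtain ⟨g', hg'⟩ := exists_equiv_hasFDerivAt_augGradient μ he hsep (Φ.symm A)
    exact (Φ.contDiffAt_symm hA hg' (contDiff_augGradient μ e).contDiffAt).contDiffWithinAt
  refine ⟨Φ.target, Φ.open_target, ?_, Φ.symm, hsmooth, fun A hA => ?_⟩
  · rwa [← augGradient_of_orthogonal μ hX]
  -- The global inverse agrees with the local one since `augGradient` is injective.
  · refine augGradient_injective μ he hsep ?_
    have h1 : augGradient μ e (Φ.symm A) = A := Φ.right_inv hA.2
    have hmem := hbij.surjOn.mapsTo_invFunOn hA.1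
    rw [h1, augGradient_of_orthogonal μ hmem]
    exact hinv.2 hA.1

end Diffeomorphism

/-! ### Pure product states -/

section PureProductStates

variable {N : ℕ} {d : Fin N → ℕ}

/-- The unitary group acts transitively on unit vectors: a unit vector is the first column of a
matrix whose columns form an orthonormal basis. -/
theorem exists_applyUnitary_single {n : ℕ} [NeZero n] (ψ : EuclideanSpace ℂ (Fin n))
    (hψ : ‖ψ‖ = 1) :
    ∃ U : Matrix.unitaryGroup (Fin n) ℂ, applyUnitary U (EuclideanSpace.single 0 1) = ψ := by
  have hv : Orthonormal ℂ (({0} : Set (Fin n)).domRestrict fun _ => ψ) :=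
    ⟨fun _ => hψ, fun i j hij => absurd (Subsingleton.elim i j) hij⟩
  obtain ⟨b, hb⟩ := hv.exists_orthonormalBasis_extension_of_card_eq (by simp)
  have hb0 := hb 0 rfl
  refine ⟨⟨Matrix.of fun i j => b j i, ?_⟩, ?_⟩
  · rw [Matrix.mem_unitaryGroup_iff']
    ext i j
    have h := orthonormal_iff_ite.mp b.orthonormal i j
    rw [Matrix.one_apply, ← h, PiLp.inner_apply, Matrix.mul_apply]
    simp [Matrix.star_apply, mul_comm]
  · ext i
    simp [applyUnitary, hb0]

theorem surjective_orbitMap (d : Fin N → ℕ) [∀ k, NeZero (d k)] :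
    Function.Surjective (orbitMap d) := by
  rintro ⟨_, ψ, hψ, rfl⟩
  choose U hU using fun k => exists_applyUnitary_single (ψ k) (hψ k)
  refine ⟨U, Subtype.ext ?_⟩
  change localConj U (productProjector _) = _
  rw [localConj_productProjector]
  exact congrArg productProjector (funext hU)

instance (d : Fin N → ℕ) [∀ k, NeZero (d k)] : CompactSpace (pureProductStates d) :=
  (surjective_orbitMap d).compactSpace (continuous_orbitMap d)

instance (d : Fin N → ℕ) [∀ k, NeZero (d k)] : (sigmaMeasure d).IsOpenPosMeasure :=
  (continuous_orbitMap d).isOpenPosMeasure_map (surjective_orbitMap d)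

/-- The identity operator. -/
noncomputable def idOp (d : Fin N → ℕ) : HermOp d := ⟨1, IsSelfAdjoint.one _⟩

theorem inner_idOp (A : HermOp d) : (inner ℝ A (idOp d) : ℂ) = A.toOp.trace := by
  rw [inner_eq_trMul, ofReal_trMul]
  change (A.toOp * 1).trace = _
  rw [mul_one]

theorem inner_idOp_eq_iff (A : HermOp d) (r : ℝ) : inner ℝ A (idOp d) = r ↔ A.toOp.trace = r := by
  rw [← inner_idOp, Complex.ofReal_inj]

theorem idOp_ne_zero (d : Fin N → ℕ) [∀ k, NeZero (d k)] : idOp d ≠ 0 := fun h => by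
  have h1 : (1 : ProdOp d) = 0 := congrArg HermOp.toOp h
  exact one_ne_zero h1

theorem trace_tensorOp (A : ∀ k, Matrix (Fin (d k)) (Fin (d k)) ℂ) :
    (tensorOp A).trace = ∏ k, (A k).trace := by
  simp only [Matrix.trace, Matrix.diag_apply, tensorOp, Matrix.of_apply]
  exact (Fintype.prod_sum fun k l => A k l l).symm

theorem trace_ketBra {n : ℕ} {ψ : EuclideanSpace ℂ (Fin n)} (hψ : ‖ψ‖ = 1) :
    (ketBra ψ).trace = 1 := by
  have h : ∑ i, ‖ψ i‖ ^ 2 = 1 := by rw [← EuclideanSpace.norm_sq_eq, hψ, one_pow]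
  simp only [Matrix.trace, Matrix.diag_apply, ketBra, Matrix.of_apply, ← starRingEnd_apply,
    Complex.mul_conj']
  exact_mod_cast h

theorem inner_pureProductStates_idOp (P : pureProductStates d) : inner ℝ P.1 (idOp d) = 1 := by
  obtain ⟨_, ψ, hψ, rfl⟩ := P
  rw [inner_idOp_eq_iff]
  change (tensorOp fun k => ketBra (ψ k)).trace = _
  rw [trace_tensorOp, Finset.prod_eq_one fun k _ => trace_ketBra (hψ k), Complex.ofReal_one]

theorem ketBra_smul {n : ℕ} (c : ℂ) (ψ : EuclideanSpace ℂ (Fin n)) :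
    ketBra (c • ψ) = (c * star c) • ketBra ψ := by
  ext i j
  simp [ketBra]
  ring

theorem tensorOp_smul (c : Fin N → ℂ) (A : ∀ k, Matrix (Fin (d k)) (Fin (d k)) ℂ) :
    tensorOp (fun k => c k • A k) = (∏ k, c k) • tensorOp A := by
  ext i j
  simp [tensorOp, Finset.prod_mul_distrib]

/-- Polarization: every matrix unit is a linear combination of operators `|ψ⟩⟨ψ|`. -/
theorem single_eq_sum_ketBra {n : ℕ} (i j : Fin n) :
    (Matrix.single i j 1 : Matrix (Fin n) (Fin n) ℂ) = ∑ r : Fin 4, (Complex.I ^ (r : ℕ) / 4) •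
      ketBra (EuclideanSpace.single i 1 + Complex.I ^ (r : ℕ) • EuclideanSpace.single j 1) := by
  -- The exponents `r` and `-r` of `I` come from the linear and the conjugate linear factor.
  have key : ∀ x y x' y' : ℂ, ∑ r : Fin 4, Complex.I ^ (r : ℕ) / 4 *
      ((x + Complex.I ^ (r : ℕ) * y) * (x' + (-Complex.I) ^ (r : ℕ) * y')) = x * y' := by
    intro x y x' y'
    have h2 : (-Complex.I) ^ 2 = -1 := by rw [neg_sq, Complex.I_sq]
    have h3 : (-Complex.I) ^ 3 = Complex.I := by rw [pow_succ, h2, neg_one_mul, neg_neg]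
    simp only [Fin.sum_univ_four, Fin.coe_ofNat_eq_mod, Nat.zero_mod, Nat.one_mod, Nat.reduceMod,
      pow_zero, pow_one, Complex.I_sq, Complex.I_pow_three, h2, h3]
    linear_combination (y * x' - x * y') / 2 * Complex.I_sq
  ext a b
  rw [Matrix.sum_apply, Matrix.single_apply]
  simp only [Matrix.smul_apply, smul_eq_mul, ketBra, Matrix.of_apply, PiLp.add_apply,
    PiLp.smul_apply, PiLp.single_apply, ← starRingEnd_apply,
    Complex.conj_I, apply_ite (starRingEnd ℂ), map_add, map_mul,
    map_pow, map_one, map_zero]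
  rw [key]
  split_ifs <;> simp_all

theorem tensorOp_sum {ι : Type*} [Fintype ι] [DecidableEq ι] (c : Fin N → ι → ℂ)
    (A : ∀ k, ι → Matrix (Fin (d k)) (Fin (d k)) ℂ) :
    tensorOp (fun k => ∑ r, c k r • A k r) =
      ∑ s : Fin N → ι, (∏ k, c k (s k)) • tensorOp fun k => A k (s k) := by
  ext i j
  simp only [tensorOp, Matrix.of_apply, Matrix.sum_apply, Matrix.smul_apply, smul_eq_mul,
    ← Finset.prod_mul_distrib]
  exact Fintype.prod_sum fun k r => c k r * A k r (i k) (j k)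

/-- A self-adjoint operator orthogonal to all pure product states is orthogonal to all tensor
products of operators `|ψ⟩⟨ψ|`, thus by polarization to all tensor products of matrix units. -/
theorem eq_zero_of_inner_pureProductStates (Y : HermOp d)
    (hY : ∀ P : pureProductStates d, inner ℝ Y P.1 = 0) : Y = 0 := by
  have h1 : ∀ ψ : ∀ k, EuclideanSpace ℂ (Fin (d k)),
      (Y.toOp * tensorOp fun k => ketBra (ψ k)).trace = 0 := by
    intro ψ
    by_cases hψ : ∀ k, ψ k ≠ 0
    · have hnorm : ∀ k, ‖(‖ψ k‖⁻¹ : ℂ) • ψ k‖ = 1 := fun k => by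
        rw [norm_smul]
        simp [norm_ne_zero_iff.mpr (hψ k)]
      have h := hY ⟨productProjector fun k => (‖ψ k‖⁻¹ : ℂ) • ψ k, _, hnorm, rfl⟩
      have h2 : (Y.toOp * tensorOp fun k => ketBra ((‖ψ k‖⁻¹ : ℂ) • ψ k)).trace = 0 := by
        have h3 := ofReal_trMul Y (productProjector fun k => (‖ψ k‖⁻¹ : ℂ) • ψ k)
        rw [← inner_eq_trMul, h, Complex.ofReal_zero] at h3
        exact h3.symm
      simp only [ketBra_smul] at h2
      rw [tensorOp_smul, Matrix.mul_smul, Matrix.trace_smul, smul_eq_mul, mul_eq_zero] at h2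
      refine h2.resolve_left (Finset.prod_ne_zero_iff.mpr fun k _ => ?_)
      simp [hψ k]
    -- If some `ψ k` vanishes, then so does the tensor product.
    · push Not at hψ
      obtain ⟨k, hk⟩ := hψ
      have : (tensorOp fun k => ketBra (ψ k)) = (0 : ProdOp d) := by
        ext i j
        exact Finset.prod_eq_zero (Finset.mem_univ k) (by simp [ketBra, hk])
      rw [this, mul_zero, Matrix.trace_zero]
  refine HermOp.ext_toOp (Matrix.ext fun i j => ?_)
  have h2 : (Matrix.single j i 1 : ProdOp d) = tensorOp fun k => Matrix.single (j k) (i k) 1 := by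
    ext a b
    simp only [tensorOp, Matrix.of_apply, Matrix.single_apply, Finset.prod_ite_zero,
      Finset.prod_const_one]
    refine if_congr ?_ rfl rfl
    simp [funext_iff, forall_and]
  have h3 : (Y.toOp * Matrix.single j i 1).trace = 0 := by
    rw [h2]
    simp only [single_eq_sum_ketBra]
    rw [tensorOp_sum, Matrix.mul_sum, Matrix.trace_sum]
    refine Finset.sum_eq_zero fun s _ => ?_
    rw [Matrix.mul_smul, Matrix.trace_smul, h1, smul_zero]
  rw [Matrix.trace_mul_single] at h3
  have h4 : Y.toOp i j = 0 := by simpa using h3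
  exact h4

theorem tracelessOps_eq (d : Fin N → ℕ) : tracelessOps d = {X | inner ℝ X (idOp d) = 0} := by
  ext X
  rw [Set.mem_ofPred_eq, inner_idOp_eq_iff, Complex.ofReal_zero]
  rfl

theorem separableInterior_eq (d : Fin N → ℕ) :
    separableInterior d = hullInterior (pureProductStates d) (idOp d) := by
  have htr : ∀ A : HermOp d, inner ℝ A (idOp d) = 1 ↔ A.toOp.trace = 1 := fun A => by
    rw [inner_idOp_eq_iff, Complex.ofReal_one]
  ext A
  constructor
  · rintro ⟨A, hA, rfl⟩
    obtain ⟨ε, hε, hball⟩ := Metric.mem_nhds_iff.mp (mem_interior_iff_mem_nhds.mp hA)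
    exact ⟨(htr A.1).mpr A.2, ε, hε, fun B hB hdist =>
      hball (show dist (⟨B, (htr B).mp hB⟩ : TraceOne d) A < ε from hdist)⟩
  · rintro ⟨hA, ε, hε, hball⟩
    refine ⟨⟨A, (htr A).mp hA⟩, mem_interior_iff_mem_nhds.mpr (Metric.mem_nhds_iff.mpr
      ⟨ε, hε, fun B hB => hball B.1 ((htr B.1).mpr B.2) hB⟩), rfl⟩

end PureProductStates

theorem mainTheorem1 {N : ℕ} (d : Fin N → ℕ) [∀ k, NeZero (d k)] :
    ContDiff ℝ ∞ (husimiW d) ∧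
      IsDiffeoOnto (husimiChi d) (tracelessOps d) (separableInterior d) := by
  refine ⟨contDiff_logMoment (sigmaMeasure d), ?_⟩
  rw [tracelessOps_eq, separableInterior_eq]
  exact isDiffeoOnto_gradient_logMoment (sigmaMeasure d) inner_pureProductStates_idOp
    (idOp_ne_zero d) eq_zero_of_inner_pureProductStates
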